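/- **Setting.** Let $\mathscr A$ be a finite acyclic automaton with one initial state, a set of final states, and a set $E$ of uniquely named transitions; its accepting paths are the path experts, $\mathscr P$ is the set of path experts and $N=|\mathscr P|$. Let $\theta_1,\dots,\theta_p$ be finitely many distinct non-empty patterns (words over an alphabet $\Sigma$); for a word $y$ let $\Theta(y)\in\mathbb R^p$ count the (contiguous) occurrences of the patterns in $y$. In round $t=1,\dots,T$ an adversary chooses outputs $\mathrm{out}_t(e)\in\Sigma$ for $e\in E$ and a target $y_t\in\Sigma^*$, possibly depending on the paths the learner sampled in earlier rounds; the learner picks $\pi_t\in\mathscr P$. The gain of a path expert $\pi$ is $\mathscr U(\mathrm{out}_t(\pi),y_t)=\Theta(\mathrm{out}_t(\pi))\cdot\Theta(y_t)$, where $\mathrm{out}_t(\pi)$ is the sequence of outputs along $\pi$. **Context-dependent automaton.** For each path segment $e_1\cdots e_r$ of $\mathscr A$ whose length is the length of some pattern let $\#e_1\cdots e_r$ be a new symbol. The transducer $T_{\mathscr A}$ of the rewrite rules $e_1\cdots e_r\to\#e_1\cdots e_r$ (empty contexts, applied simultaneously at every position) maps $x\in E^*$ to the string of the symbols of all such segments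 occurring in $x$, read from left to right by the position where they end (and by decreasing length at equal end positions). Let $\mathscr A'$ be an acyclic deterministic finite automaton without $\epsilon$-transitions for the output projection $\Pi(\mathscr A\circ T_{\mathscr A})$, i.e. accepting exactly the strings $T_{\mathscr A}(\pi)$, $\pi\in\mathscr P$. Let $M$ be its number of transitions and $K$ the length of its longest accepting path. The gain $g_{t,e'}$ of a transition $e'$ labelled $\#e_1\cdots e_r$ is $[\Theta(y_t)]_k$ if $\mathrm{out}_t(e_1)\cdots\mathrm{out}_t(e_r)=\theta_k$ for some $k$, and $0$ otherwise. Let $B$ be an upper bound for all transition gains in the $T$ rounds, and let $C$ be a non-empty set of covering paths: accepting paths of $\mathscr A'$ such that every transition of $\mathscr A'$ lies on some path in $C$. **Algorithm CDSB** (semi-bandit setting; parameters $\eta,\beta>0$, $0<\gamma\le1$). Start with weights $w_1(e')=1$. In round $t$ let $p_t(\pi')\propto\prod_{e'\in\pi'}w_t(e')$ on the accepting paths of $\mathscr A'$, let $\mu$ be uniform on $C$, sample $\pi'_t\sim(1-\gamma)p_t+\gamma\mu$ and predict with a path expert $\pi_t$ such that $T_{\mathscr A}(\pi_t)$ is the label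 of $\pi'_t$ (a fixed choice $\pi'\mapsto\pi$). Let $q_{t,e'}$ be the probability that the sampled path contains $e'$, put $\widetilde g_{t,e'}=(g_{t,e'}+\beta)/q_{t,e'}$ if $e'\in\pi'_t$ and $\widetilde g_{t,e'}=\beta/q_{t,e'}$ otherwise, and $w_{t+1}(e')=w_t(e')\exp(\eta\,\widetilde g_{t,e'})$. **Theorem.** For all such $\mathscr A$, $\theta_1,\dots,\theta_p$, $\mathscr A'$, $C$, every horizon $T$, every $B$ and every $\delta\in(0,1)$ there are parameters $\eta,\beta>0$ and $0<\gamma\le1$ such that, for every adversary whose transition gains are bounded by $B$ and every choice of the predicted experts as above, with probability at least $1-\delta$ the algorithm CDSB satisfies $$\forall\,\pi^*\in\mathscr P:\quad \sum_{t=1}^T\Big(\mathscr U(\mathrm{out}_t(\pi^*),y_t)-\mathscr U(\mathrm{out}_t(\pi_t),y_t)\Big)\;\le\;2B\sqrt{TK}\,\Big(\sqrt{4K|C|\ln N}+\sqrt{M\ln\tfrac M\delta}\Big).$$ (If $M=0$, then $K=0$ and the right-hand side is read as $0$.) -/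

import Mathlib

open scoped Classical in
/-- Number of occurrences of the (contiguous) pattern `θ` in the sequence `y`. -/
noncomputable def occurrences {Sym : Type*} (θ y : List Sym) : ℕ :=
  ((Finset.range (y.length + 1)).filter fun i => θ <+: y.drop i).card

/-- The count-based gain `Θ(u) ⬝ Θ(y)`, where `Θ(·)` is the vector, indexed by the patterns
`θ ∈ P`, of the numbers of occurrences. -/
noncomputable def countGain {Sym : Type*} (P : Finset (List Sym)) (u y : List Sym) : ℝ :=
  ∑ θ ∈ P, (occurrences θ u : ℝ) * (occurrences θ y : ℝ)

/-- `IsWalk src dst p l q`: the transitions in `l` are consecutive and lead from `p` to `q`. -/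
def IsWalk {Q E : Type*} (src dst : E → Q) : Q → List E → Q → Prop
  | p, [], q => p = q
  | p, e :: l, q => src e = p ∧ IsWalk src dst (dst e) l q

/-- An acyclic automaton with states `Q` and transitions `E`, one initial state and a set of
final states. The elements of `E` serve as the (unique) names of the transitions. -/
structure PathAutomaton (Q E : Type*) where
  init : Q
  final : Set Q
  src : E → Q
  dst : E → Q
  acyclic : ∀ (p : Q) (l : List E), IsWalk src dst p l p → l = []

namespace PathAutomaton

variable {Q E : Type*} (A : PathAutomaton Q E)

/-- `l` is a path from the initial state to a final state. -/
def Accepts (l : List E) : Prop := ∃ q ∈ A.final, IsWalk A.src A.dst A.init l q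

/-- `l` is a path segment (a path between two arbitrary states). -/
def IsSegment (l : List E) : Prop := ∃ p q, IsWalk A.src A.dst p l q

/-- The accepting paths. For the expert automaton these are the path experts. -/
def AcceptingPath : Type _ := {l : List E // A.Accepts l}

end PathAutomaton

theorem isWalk_append {Q E : Type*} (src dst : E → Q) (l₁ l₂ : List E) (p q : Q) :
    IsWalk src dst p (l₁ ++ l₂) q ↔
      ∃ r, IsWalk src dst p l₁ r ∧ IsWalk src dst r l₂ q := by
  induction l₁ generalizing p with
  | nil => simp [IsWalk]
  | cons e l ih => simp [IsWalk, ih, and_assoc]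

theorem PathAutomaton.nodup_of_isWalk {Q E : Type*} (A : PathAutomaton Q E) (l : List E)
    (p q : Q) (h : IsWalk A.src A.dst p l q) : l.Nodup := by
  induction l generalizing p with
  | nil => simp
  | cons e l ih =>
    refine List.nodup_cons.2 ⟨fun he => ?_, ih _ h.2⟩
    obtain ⟨l₁, l₂, rfl⟩ := List.append_of_mem he
    obtain ⟨r, h1, h2⟩ := (isWalk_append _ _ _ _ _ _).1 h.2
    have := A.acyclic (A.src e) (e :: l₁) ⟨rfl, by rw [h2.1]; exact h1⟩
    simp at this

instance PathAutomaton.finite_acceptingPath {Q E : Type*} [Finite E] (A : PathAutomaton Q E) :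
    Finite A.AcceptingPath := by
  classical
  have := Fintype.ofFinite E
  refine Finite.of_injective
    (fun π : A.AcceptingPath => (⟨π.1, ?_⟩ : {l : List E // l.Nodup})) ?_
  · obtain ⟨q, -, h⟩ := π.2
    exact A.nodup_of_isWalk _ _ _ h
  · intro a b h
    exact Subtype.ext (congrArg (fun z => z.1) h)

noncomputable instance PathAutomaton.fintype_acceptingPath {Q E : Type*} [Finite E]
    (A : PathAutomaton Q E) : Fintype A.AcceptingPath := Fintype.ofFinite _

namespace PathAutomaton

variable {Q E : Type*} (A : PathAutomaton Q E)

/-- The number of accepting paths. -/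
noncomputable def numPaths : ℕ := Nat.card A.AcceptingPath

/-- The length (number of transitions) of the longest accepting path. -/
noncomputable def longestPath [Finite E] : ℕ :=
  Finset.univ.sup fun π : A.AcceptingPath => π.1.length

/-- `C` is a set of covering paths: every transition lies on some accepting path in `C`. -/
def Covers (C : Finset A.AcceptingPath) : Prop := ∀ e : E, ∃ π ∈ C, e ∈ π.1

/-! ### The context-dependent automaton

A symbol `#e₁⋯e_r` is represented by the list `[e₁, …, e_r]` of transitions of `A`. -/

/-- The alphabet of glued symbols `#e₁⋯e_r`: all path segments of `A` whose length is the length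
of one of the patterns. -/
def glued {Sym : Type*} (P : Finset (List Sym)) : Set (List E) :=
  {s | A.IsSegment s ∧ ∃ θ ∈ P, θ.length = s.length}

open scoped Classical in
/-- The output of the simultaneous application, at every position of `x`, of all the rewrite rules
`e₁⋯e_r → #e₁⋯e_r` with empty contexts. Reading `x` from left to right, after each transition
the symbols of all the segments that end there are emitted (in order of decreasing length);
where no rule applies, nothing is emitted. -/
noncomputable def rewrite {Sym : Type*} (P : Finset (List Sym)) (x : List E) : List (List E) :=
  x.inits.flatMap fun u => u.tails.filter fun s => s ∈ A.glued P

/-- The relation (indicator function) of the transducer `T_A` of the rewrite rules. -/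
def transducer {Sym : Type*} (P : Finset (List Sym)) (x : List E) (w : List (List E)) : Prop :=
  w = A.rewrite P x

/-- The composition `A ∘ T_A`: the product of the indicators of `A` and of `T_A`. -/
def composition {Sym : Type*} (P : Finset (List Sym)) (x : List E) (w : List (List E)) : Prop :=
  A.Accepts x ∧ A.transducer P x w

/-- The projection of `A ∘ T_A` on its output: the strings of glued symbols that it accepts. -/
def projection {Sym : Type*} (P : Finset (List Sym)) (w : List (List E)) : Prop :=
  ∃ x, A.composition P x w

/-- The acyclic automaton `A'` with transitions `X`, labelled by `lab`, is a deterministic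
automaton (without `ε`-transitions) for the output projection of `A ∘ T_A`. -/
structure IsContextAutomaton {Sym Q' X : Type*} (P : Finset (List Sym))
    (A' : PathAutomaton Q' X) (lab : X → List E) : Prop where
  deterministic : ∀ a b : X, A'.src a = A'.src b → lab a = lab b → a = b
  language : ∀ w : List (List E),
    (∃ l, A'.Accepts l ∧ l.map lab = w) ↔ A.projection P w

/-- Every finite language is accepted by such an automaton (here: by its prefix tree). Hence a
context-dependent automaton with a set of covering paths always exists. -/
theorem exists_isContextAutomaton.{u, v, z} {Q : Type v} {E : Type u} {Sym : Type z} [Finite E] (A : PathAutomaton Q E)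
    [Nonempty A.AcceptingPath] (P : Finset (List Sym)) :
    ∃ (X : Type u) (_ : Finite X) (A' : PathAutomaton (List (List E)) X) (lab : X → List E)
      (C : Finset A'.AcceptingPath),
      A.IsContextAutomaton P A' lab ∧ C.Nonempty ∧ A'.Covers C := by
  classical
  set L : Set (List (List E)) := {w | A.projection P w} with hL
  have hfin : L.Finite := by
    have : L = Set.range fun π : A.AcceptingPath => A.rewrite P π.1 := by
      ext w
      constructor
      · rintro ⟨x, hx, hw⟩
        exact ⟨⟨x, hx⟩, hw.symm⟩
      · rintro ⟨π, rfl⟩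
        exact ⟨π.1, π.2, rfl⟩
    rw [this]
    exact Set.finite_range _
  let X := {u : List (List E) // u ≠ [] ∧ ∃ w ∈ L, u <+: w}
  have hX : Finite X := by
    have h1 : (⋃ w ∈ L, {u : List (List E) | u <+: w}).Finite :=
      hfin.biUnion fun w _ => (List.finite_toSet w.inits).subset fun u hu => by
        simpa using hu
    have h2 : {u : List (List E) | u ≠ [] ∧ ∃ w ∈ L, u <+: w}.Finite :=
      h1.subset fun u hu => by simpa using hu.2
    exact h2.to_subtype
  let src : X → List (List E) := fun u => u.1.dropLast
  let dst : X → List (List E) := fun u => u.1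
  let lab : X → List E := fun u => u.1.getLast u.2.1
  have key : ∀ (l : List X) (p q : List (List E)), IsWalk src dst p l q →
      q = p ++ l.map lab := by
    intro l
    induction l with
    | nil => intro p q h; simpa [IsWalk] using h.symm
    | cons u l ih =>
      rintro p q ⟨h1, h2⟩
      rw [ih _ _ h2, ← h1]
      have : u.1.dropLast ++ [u.1.getLast u.2.1] = u.1 := List.dropLast_append_getLast u.2.1
      simp only [src, dst, lab, List.map_cons]
      conv_lhs => rw [← this]
      simp
  have conv : ∀ (w p : List (List E)), (∃ v ∈ L, p ++ w <+: v) →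
      ∃ l : List X, IsWalk src dst p l (p ++ w) ∧ l.map lab = w := by
    intro w
    induction w with
    | nil => intro p _; exact ⟨[], by simp [IsWalk], rfl⟩
    | cons a w ih =>
      rintro p ⟨v, hv, hpv⟩
      have hpre : p ++ [a] <+: v := by
        refine List.IsPrefix.trans ?_ hpv
        exact ⟨w, by simp⟩
      obtain ⟨l, hl1, hl2⟩ := ih (p ++ [a]) ⟨v, hv, by simpa using hpv⟩
      refine ⟨⟨p ++ [a], by simp, v, hv, hpre⟩ :: l, ⟨?_, ?_⟩, ?_⟩
      · simp [src]
      · simpa [dst] using hl1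
      · simp [lab, hl2]
  let A' : PathAutomaton (List (List E)) X :=
    { init := [], final := L, src := src, dst := dst
      acyclic := fun p l h => by simpa using key l p p h }
  refine ⟨X, hX, A', lab, Finset.univ, ⟨?_, ?_⟩, ?_, ?_⟩
  · intro a b h1 h2
    apply Subtype.ext
    rw [← List.dropLast_append_getLast a.2.1, ← List.dropLast_append_getLast b.2.1]
    exact congrArg₂ (fun s t => s ++ [t]) h1 h2
  · intro w
    constructor
    · rintro ⟨l, ⟨q, hq, hl⟩, rfl⟩
      have := key l _ _ hl
      rw [this] at hq
      exact hq
    · intro hw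
      obtain ⟨l, h1, h2⟩ := conv w [] ⟨w, hw, by simp⟩
      exact ⟨l, ⟨w, hw, h1⟩, h2⟩
  · obtain ⟨π⟩ := ‹Nonempty A.AcceptingPath›
    obtain ⟨l, h1, -⟩ := conv (A.rewrite P π.1) [] ⟨_, ⟨π.1, π.2, rfl⟩, by simp⟩
    exact ⟨⟨l, _, ⟨π.1, π.2, rfl⟩, h1⟩, Finset.mem_univ _⟩
  · intro u
    obtain ⟨w, hw, t, ht⟩ := u.2.2
    obtain ⟨l₁, h1, -⟩ := conv u.1.dropLast []
      ⟨w, hw, (List.dropLast_prefix _).trans ⟨t, ht⟩⟩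
    obtain ⟨l₂, h2, -⟩ := conv t u.1 ⟨w, hw, by rw [ht]⟩
    refine ⟨⟨l₁ ++ u :: l₂, w, hw, ?_⟩, Finset.mem_univ _, by simp⟩
    refine (isWalk_append _ _ _ _ _ _).2 ⟨u.1.dropLast, by simpa using h1, rfl, ?_⟩
    rw [← ht]
    exact h2

/-- `π'` is the accepting path of the context-dependent automaton that corresponds to the
path expert `π`. -/
def Corresponds {Sym Q' X : Type*} (P : Finset (List Sym)) (A' : PathAutomaton Q' X)
    (lab : X → List E) (π : A.AcceptingPath) (π' : A'.AcceptingPath) : Prop :=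
  A.transducer P π.1 (π'.1.map lab)

end PathAutomaton

open scoped Classical in
/-- The gain of a transition with label `s = #e₁⋯e_r` in a round with outputs `out` and target
`y`: `Θ(y)_θ` if `out e₁ ⋯ out e_r` is a pattern `θ ∈ P`, and `0` otherwise. -/
noncomputable def transitionGain {E Sym : Type*} (P : Finset (List Sym)) (out : E → Sym)
    (y : List Sym) (s : List E) : ℝ :=
  if s.map out ∈ P then (occurrences (s.map out) y : ℝ) else 0

/-! ### The algorithm

It runs on the context-dependent automaton, here `A`, with transitions `X`. A history is the list
of the paths sampled so far, the most recent one first. -/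

/-- The parameters of the algorithm. -/
structure CDSBParams where
  η : ℝ
  β : ℝ
  γ : ℝ
  η_pos : 0 < η
  β_pos : 0 < β
  γ_pos : 0 < γ
  γ_le_one : γ ≤ 1

namespace CDSB

theorem prod_map_pos {X : Type*} {w : X → ℝ} (hw : ∀ e, 0 < w e) (l : List X) : 0 < (l.map w).prod := by
  induction l with
  | nil => simp
  | cons e l ih => simpa using mul_pos (hw e) ih

variable {Q X : Type*} [Finite X] (A : PathAutomaton Q X) (C : Finset A.AcceptingPath)
  (prm : CDSBParams)

/-- The distribution on accepting paths with `p(π) ∝ ∏_{e ∈ π} w(e)`. -/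
noncomputable def pathProb (w : X → ℝ) (π : A.AcceptingPath) : ℝ :=
  (π.1.map w).prod / ∑ ρ : A.AcceptingPath, (ρ.1.map w).prod

open scoped Classical in
/-- The uniform distribution `μ` over `C`. -/
noncomputable def coverProb (π : A.AcceptingPath) : ℝ :=
  if π ∈ C then 1 / (C.card : ℝ) else 0

/-- The sampling distribution `(1 - γ) p + γ μ`. -/
noncomputable def sampleProb (w : X → ℝ) (π : A.AcceptingPath) : ℝ :=
  (1 - prm.γ) * pathProb A w π + prm.γ * coverProb A C π

open scoped Classical in
/-- The flow through the transition `e` under the sampling distribution, i.e. the probability that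
the sampled path contains `e`. -/
noncomputable def flow (w : X → ℝ) (e : X) : ℝ :=
  ∑ π : A.AcceptingPath, if e ∈ π.1 then sampleProb A C prm w π else 0

open scoped Classical in
/-- The surrogate gain of the transition `e` when the path `π` was sampled with current weights `w`
and `g` are the gains of the transitions; only gains of transitions of `π` are used. -/
noncomputable def surrogateGain (w : X → ℝ) (g : X → ℝ) (π : A.AcceptingPath) (e : X) : ℝ :=
  if e ∈ π.1 then (g e + prm.β) / flow A C prm w e else prm.β / flow A C prm w e

/-- The transition weights after a history, where `g h` are the gains of the transitions in the
round that follows the history `h`. They start from `1` and are multiplied in each round by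
`exp (η * surrogate gain)`. -/
noncomputable def weights (g : List A.AcceptingPath → X → ℝ) : List A.AcceptingPath → X → ℝ
  | [], _ => 1
  | π :: h, e =>
    weights g h e * Real.exp (prm.η * surrogateGain A C prm (weights g h) (g h) π e)

theorem weights_pos (g : List A.AcceptingPath → X → ℝ) (h : List A.AcceptingPath) (e : X) :
    0 < weights A C prm g h e := by
  induction h with
  | nil => simp [weights]
  | cons π h ih => exact mul_pos ih (Real.exp_pos _)

theorem sampleProb_nonneg {w : X → ℝ} (hw : ∀ e, 0 < w e) (π : A.AcceptingPath) :
    0 ≤ sampleProb A C prm w π := by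
  have h1 : 0 ≤ pathProb A w π :=
    div_nonneg (prod_map_pos hw _).le (Finset.sum_nonneg fun ρ _ => (prod_map_pos hw _).le)
  have h2 : 0 ≤ coverProb A C π := by unfold coverProb; split_ifs <;> positivity
  exact add_nonneg (mul_nonneg (by linarith [prm.γ_le_one]) h1) (mul_nonneg prm.γ_pos.le h2)

theorem sum_sampleProb (hC : C.Nonempty) {w : X → ℝ} (hw : ∀ e, 0 < w e) :
    ∑ π : A.AcceptingPath, sampleProb A C prm w π = 1 := by
  have hZ : 0 < ∑ ρ : A.AcceptingPath, (ρ.1.map w).prod :=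
    Finset.sum_pos (fun ρ _ => prod_map_pos hw _) ⟨hC.choose, Finset.mem_univ _⟩
  have hc : (C.card : ℝ) ≠ 0 := by exact_mod_cast hC.card_pos.ne'
  have h1 : ∑ π : A.AcceptingPath, pathProb A w π = 1 := by
    simp only [pathProb]
    rw [← Finset.sum_div, div_self hZ.ne']
  have h2 : ∑ π : A.AcceptingPath, coverProb A C π = 1 := by
    classical
    simp only [coverProb]
    rw [← Finset.sum_filter, Finset.sum_const, nsmul_eq_mul]
    have : (Finset.univ.filter fun a => a ∈ C) = C := by ext; simp
    rw [this]
    field_simp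
  simp only [sampleProb]
  rw [Finset.sum_add_distrib, ← Finset.mul_sum, ← Finset.mul_sum, h1, h2]
  ring

/-- The conditional law of the next sampled path, given the history `h`. -/
noncomputable def step (hC : C.Nonempty) (g : List A.AcceptingPath → X → ℝ)
    (h : List A.AcceptingPath) : PMF A.AcceptingPath :=
  PMF.ofFintype (fun π => ENNReal.ofReal (sampleProb A C prm (weights A C prm g h) π)) (by
    have hw := weights_pos A C prm g h
    rw [← ENNReal.ofReal_sum_of_nonneg (fun π _ => sampleProb_nonneg A C prm hw π),
      sum_sampleProb A C prm hC hw, ENNReal.ofReal_one])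

/-- The law of the history after `t` rounds. -/
noncomputable def law (hC : C.Nonempty) (g : List A.AcceptingPath → X → ℝ) :
    ℕ → PMF (List A.AcceptingPath)
  | 0 => PMF.pure []
  | t + 1 => (law hC g t).bind fun h => (step A C prm hC g h).map fun π => π :: h

end CDSB

/-- The cumulative gain of the fixed path expert `π₀` minus that of the learner, who predicts with
the path expert `σ π'` when `π'` is sampled. In the round that follows the history `h`, the
transitions output `out h` and the target sequence is `y h`. -/
noncomputable def cumulativeRegret {E Sym Paths' : Type*} (P : Finset (List Sym))
    (out : List Paths' → E → Sym) (y : List Paths' → List Sym) (σ : Paths' → List E)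
    (π₀ : List E) : List Paths' → ℝ
  | [] => 0
  | π' :: h =>
    cumulativeRegret P out y σ π₀ h +
      (countGain P (π₀.map (out h)) (y h) - countGain P ((σ π').map (out h)) (y h))

/-! Each occurrence of a pattern in an expert's output comes from one path segment, so the count
gain of an expert is the sum of the transition gains over its rewritten string
(`countGain_eq_sum_rewrite`). Regret against experts thus becomes regret in an online path problem
on `A'` with additive gains. Since `A'` is deterministic and accepts exactly the rewritten experts,
it has at most N accepting paths.

The path problem is solved by an exponential-weights argument with optimistic estimates. The term `β
/ q` makes exp((β/B²) · (cumulative gain − cumulative surrogate gain)) a supermartingale for each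
transition (`sum_sampleProb_mul_exp_le`). Markov's inequality for the sum over the M transitions
then shows that, with probability at least 1 − δ, no surrogate falls short by more than (B²/β)
ln(M/δ). The union is over transitions, not paths, and serves all experts at once.

On that event the argument is deterministic. The total path weight grows at a rate governed by the
learner's gain plus a second-order error (`sum_prod_map_le`), and it dominates the weight of the
path with the best surrogate gain. The cover is used twice: it gives q ≥ γ/|C|, and it bounds the
sum of all surrogates by |C| times that best path (`regret_le`). Balancing the error terms gives the
bound when T is large (`exists_params`); otherwise the bound already exceeds the trivial regret TKB.
-/

/-! ### Counting occurrences by prefixes and suffixes -/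

theorem List.sum_inits_tails {α : Type*} (f : List α → ℝ) (z : List α) :
    (z.inits.map fun u => (u.tails.map f).sum).sum =
      (z.tails.map fun t => (t.inits.map f).sum).sum := by
  induction z with
  | nil => simp
  | cons a z ih =>
    simp only [List.inits_cons, List.tails_cons, List.map_cons, List.sum_cons, List.map_map,
      ← ih, Function.comp_def, List.sum_map_add, show ([] : List α).tails = [[]] from rfl, List.map_nil, List.sum_nil]
    ring

-- Prefixes of `t` have pairwise different lengths, so `t.inits` has no duplicates and `θ` is met at
-- most once.
open scoped Classical in
theorem List.sum_inits_ite_eq {α : Type*} (θ t : List α) :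
    (t.inits.map fun s => if s = θ then (1 : ℝ) else 0).sum = if θ <+: t then 1 else 0 := by
  have h := List.sum_toFinset (fun s => if s = θ then (1 : ℝ) else 0) (l := t.inits)
    (by rw [List.nodup_iff_injective_get]
        intro i j hij
        have := congrArg List.length hij
        simp only [List.get_eq_getElem, List.getElem_inits, List.length_take] at this
        have hi := i.2
        have hj := j.2
        simp only [List.length_inits] at hi hj
        apply Fin.ext
        omega)
  rw [← h, Finset.sum_ite_eq']
  simp

open scoped Classical in
theorem occurrences_eq_sum_tails {Sym : Type*} (θ y : List Sym) :
    (occurrences θ y : ℝ) = (y.tails.map fun t => if θ <+: t then (1 : ℝ) else 0).sum := by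
  have h : y.tails = (List.range (y.length + 1)).map fun i => y.drop i := by
    apply List.ext_getElem
    · simp
    · intro i h1 h2
      simp
  rw [h, occurrences, Finset.card_filter, List.map_map]
  push_cast
  rw [Finset.sum_eq_multiset_sum]
  simp [Function.comp_def, Multiset.range]

-- The definition indexes occurrences by where they start. Exchanging the order of summation over
-- contiguous pieces indexes them by where they end, which is the order in which `rewrite` emits
-- symbols.
open scoped Classical in
theorem occurrences_eq_sum_inits {Sym : Type*} (θ y : List Sym) :
    (occurrences θ y : ℝ) =
      (y.inits.map fun u => (u.tails.map fun s => if s = θ then (1 : ℝ) else 0).sum).sum := by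
  rw [List.sum_inits_tails, occurrences_eq_sum_tails]
  simp only [List.sum_inits_ite_eq]

theorem List.sum_flatMap_map {α β : Type*} (l : List α) (k : α → List β) (f : β → ℝ) :
    ((l.flatMap k).map f).sum = (l.map fun a => ((k a).map f).sum).sum := by
  induction l with
  | nil => simp
  | cons a l ih => simp [ih]

theorem List.sum_map_filter_of_eq_zero {α : Type*} (l : List α) (p : α → Bool) (f : α → ℝ)
    (h : ∀ a ∈ l, p a = false → f a = 0) : ((l.filter p).map f).sum = (l.map f).sum := by
  induction l with
  | nil => simp
  | cons a l ih =>
    have ih' := ih fun b hb => h b (List.mem_cons_of_mem _ hb)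
    cases hp : p a
    · simp [hp, ih', h a (by simp) hp]
    · simp [hp, ih']

theorem List.sum_map_finset_sum {α ι : Type*} (l : List α) (s : Finset ι) (f : ι → α → ℝ) :
    (l.map fun a => ∑ i ∈ s, f i a).sum = ∑ i ∈ s, (l.map (f i)).sum := by
  induction l with
  | nil => simp
  | cons a l ih => simp [ih, Finset.sum_add_distrib]

theorem transitionGain_nonneg {E Sym : Type*} (P : Finset (List Sym)) (out : E → Sym)
    (y : List Sym) (s : List E) : 0 ≤ transitionGain P out y s := by
  unfold transitionGain
  split_ifs <;> positivity

open scoped Classical in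
theorem transitionGain_eq_sum {E Sym : Type*} (P : Finset (List Sym)) (out : E → Sym)
    (y : List Sym) (s : List E) :
    transitionGain P out y s =
      ∑ θ ∈ P, (if s.map out = θ then (1 : ℝ) else 0) * (occurrences θ y : ℝ) := by
  simp [transitionGain, ite_mul]

theorem countGain_eq_sum_inits {E Sym : Type*} (P : Finset (List Sym)) (out : E → Sym)
    (y : List Sym) (x : List E) :
    countGain P (x.map out) y =
      (x.inits.map fun u => (u.tails.map (transitionGain P out y)).sum).sum := by
  classical
  simp only [funext (transitionGain_eq_sum P out y), List.sum_map_finset_sum, countGain]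
  refine Finset.sum_congr rfl fun θ _ => ?_
  simp only [occurrences_eq_sum_inits θ (x.map out), List.sum_map_mul_right, List.map_inits,
    List.map_map, Function.comp_def, List.map_tails]

/-! ### Experts versus accepting paths of the context-dependent automaton -/

namespace PathAutomaton

variable {Q E : Type*} (A : PathAutomaton Q E)

theorem isSegment_of_isWalk_of_infix {x s : List E} {p q : Q} (h : IsWalk A.src A.dst p x q)
    (hs : s <:+: x) : A.IsSegment s := by
  obtain ⟨a, b, rfl⟩ := hs
  obtain ⟨r, h1, -⟩ := (isWalk_append _ _ _ _ _ _).1 h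
  obtain ⟨r', -, h2⟩ := (isWalk_append _ _ _ _ _ _).1 h1
  exact ⟨_, _, h2⟩

/-- The count-based gain of an accepted path is the sum of the gains of its rewritten symbols. -/
theorem countGain_eq_sum_rewrite {Sym : Type*} (P : Finset (List Sym)) (out : E → Sym)
    (y : List Sym) {x : List E} (hx : A.Accepts x) :
    countGain P (x.map out) y = ((A.rewrite P x).map (transitionGain P out y)).sum := by
  classical
  obtain ⟨q, -, hw⟩ := hx
  rw [countGain_eq_sum_inits, rewrite, List.sum_flatMap_map]
  congr 1
  refine List.map_congr_left fun u hu => ?_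
  -- The filter loses no gain: a suffix of a prefix of an accepted path is a segment, so it is
  -- discarded only if no pattern has its length, and then its output is not a pattern.
  rw [List.sum_map_filter_of_eq_zero]
  intro s hs hns
  rw [transitionGain, if_neg]
  intro hmem
  have hns' : ¬ s ∈ A.glued P := by simpa using hns
  refine hns' ⟨A.isSegment_of_isWalk_of_infix hw ?_, _, hmem, by simp⟩
  exact ((List.mem_tails _ _).1 hs).isInfix.trans ((List.mem_inits _ _).1 hu).isInfix

theorem eq_of_isWalk_of_map_eq {L : Type*} (lab : E → L)
    (hdet : ∀ a b : E, A.src a = A.src b → lab a = lab b → a = b) :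
    ∀ (l₁ l₂ : List E) (p q₁ q₂ : Q), IsWalk A.src A.dst p l₁ q₁ → IsWalk A.src A.dst p l₂ q₂ →
      l₁.map lab = l₂.map lab → l₁ = l₂
  | [], [], _, _, _, _, _, _ => rfl
  | [], _ :: _, _, _, _, _, _, h => by simp at h
  | _ :: _, [], _, _, _, _, _, h => by simp at h
  | a :: l₁, b :: l₂, p, q₁, q₂, h1, h2, h => by
    simp only [List.map_cons, List.cons.injEq] at h
    have hab : a = b := hdet a b (h1.1.trans h2.1.symm) h.1
    subst hab
    rw [eq_of_isWalk_of_map_eq lab hdet l₁ l₂ _ _ _ h1.2 h2.2 h.2]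

variable {Q' X Sym : Type*} {P : Finset (List Sym)} {A' : PathAutomaton Q' X}
  {lab : X → List E}

theorem Corresponds.countGain_eq {A : PathAutomaton Q E} {π : A.AcceptingPath} {π' : A'.AcceptingPath}
    (h : A.Corresponds P A' lab π π') (out : E → Sym) (y : List Sym) :
    countGain P (π.1.map out) y = (π'.1.map fun e => transitionGain P out y (lab e)).sum := by
  rw [A.countGain_eq_sum_rewrite P out y π.2, ← (show π'.1.map lab = A.rewrite P π.1 from h),
    List.map_map]
  rfl

theorem IsContextAutomaton.exists_corresponds {A : PathAutomaton Q E} (hA' : A.IsContextAutomaton P A' lab)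
    (π : A.AcceptingPath) : ∃ π' : A'.AcceptingPath, A.Corresponds P A' lab π π' := by
  obtain ⟨l, hl, hl'⟩ := (hA'.language (A.rewrite P π.1)).2 ⟨π.1, π.2, rfl⟩
  exact ⟨⟨l, hl⟩, hl'⟩

/-- In a deterministic automaton the label string determines the path. This is what allows ln N,
with N the number of experts, to replace the logarithm of the number of paths of `A'`. -/
theorem IsContextAutomaton.injective_of_corresponds {A : PathAutomaton Q E} (hA' : A.IsContextAutomaton P A' lab)
    {σ : A'.AcceptingPath → A.AcceptingPath} (hσ : ∀ π', A.Corresponds P A' lab (σ π') π') :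
    Function.Injective σ := by
  intro a b hab
  have h1 : a.1.map lab = A.rewrite P (σ a).1 := hσ a
  have h2 : b.1.map lab = A.rewrite P (σ b).1 := hσ b
  obtain ⟨q₁, -, w₁⟩ := a.2
  obtain ⟨q₂, -, w₂⟩ := b.2
  refine Subtype.ext (A'.eq_of_isWalk_of_map_eq lab hA'.deterministic _ _ _ _ _ w₁ w₂ ?_)
  rw [h1, h2, hab]

theorem AcceptingPath.nodup {A : PathAutomaton Q E} (π : A.AcceptingPath) : π.1.Nodup := by
  obtain ⟨q, -, h⟩ := π.2
  exact A.nodup_of_isWalk _ _ _ h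

theorem AcceptingPath.length_le_longestPath [Finite E] {A : PathAutomaton Q E} (π : A.AcceptingPath) :
    π.1.length ≤ A.longestPath :=
  Finset.le_sup (f := fun π : A.AcceptingPath => π.1.length) (Finset.mem_univ π)

theorem longestPath_le_card [Fintype E] : A.longestPath ≤ Fintype.card E :=
  Finset.sup_le fun π _ => (AcceptingPath.nodup π).length_le_card

end PathAutomaton

/-! ### Expectations under the law of the history -/

open scoped ENNReal

theorem PMF.tsum_bind_mul {α β : Type*} (p : PMF α) (f : α → PMF β) (F : β → ℝ≥0∞) :
    ∑' b, (p.bind f) b * F b = ∑' a, p a * ∑' b, f a b * F b := by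
  simp only [PMF.bind_apply, ← ENNReal.tsum_mul_right, ← ENNReal.tsum_mul_left]
  rw [ENNReal.tsum_comm]
  simp only [mul_assoc]

theorem PMF.tsum_map_mul {α β : Type*} (p : PMF α) (f : α → β) (F : β → ℝ≥0∞) :
    ∑' b, (p.map f) b * F b = ∑' a, p a * F (f a) := by
  rw [PMF.map, PMF.tsum_bind_mul]
  refine tsum_congr fun a => ?_
  congr 1
  rw [tsum_eq_single (f a)]
  · simp
  · intro b hb
    simp [PMF.pure_apply, hb]

/-- Markov's inequality for a discrete law, in the form of a lower bound. -/
theorem PMF.one_sub_le_toOuterMeasure {α : Type*} (p : PMF α) (F : α → ℝ≥0∞) (S : Set α)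
    {d : ℝ≥0∞} (hF : ∑' a, p a * F a ≤ d) (hS : ∀ a, p a ≠ 0 → a ∉ S → 1 ≤ F a) :
    1 - d ≤ p.toOuterMeasure S := by
  rw [PMF.toOuterMeasure_apply]
  refine tsub_le_iff_right.2 ?_
  calc (1 : ℝ≥0∞) = ∑' a, p a := p.tsum_coe.symm
    _ ≤ ∑' a, (S.indicator p a + p a * F a) := by
        refine ENNReal.tsum_le_tsum fun a => ?_
        by_cases ha : a ∈ S
        · simp [ha]
        · by_cases h0 : p a = 0
          · simp [h0]
          · simpa [ha] using le_mul_of_one_le_right (zero_le (a := p a)) (hS a h0 ha)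
    _ = ∑' a, S.indicator p a + ∑' a, p a * F a := ENNReal.tsum_add
    _ ≤ _ := by gcongr

namespace CDSB

variable {Q X : Type*} [Finite X] (A : PathAutomaton Q X) (C : Finset A.AcceptingPath)
  (prm : CDSBParams) (hC : C.Nonempty) (g : List A.AcceptingPath → X → ℝ)

theorem length_eq_of_law_ne_zero (t : ℕ) (h : List A.AcceptingPath)
    (hh : law A C prm hC g t h ≠ 0) : h.length = t := by
  induction t generalizing h with
  | zero =>
    have := (PMF.mem_support_pure_iff _ _).1 ((PMF.mem_support_iff _ _).2 hh)
    simp [this]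
  | succ t ih =>
    obtain ⟨h', hh', h2⟩ := (PMF.mem_support_bind_iff _ _ _).1 ((PMF.mem_support_iff _ _).2 hh)
    obtain ⟨π, -, rfl⟩ := (PMF.mem_support_map_iff _ _ _).1 h2
    simp [ih h' hh']

/-- A nonnegative supermartingale has expectation at most its initial value. The one-step inequality
is asked only for histories shorter than `T`, because the gains are bounded only there. -/
theorem tsum_law_mul_le (T : ℕ) (F : List A.AcceptingPath → ℝ) (hF0 : ∀ h, 0 ≤ F h)
    (hF : ∀ h, h.length < T →
      ∑ π, sampleProb A C prm (weights A C prm g h) π * F (π :: h) ≤ F h) :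
    ∑' h, law A C prm hC g T h * ENNReal.ofReal (F h) ≤ ENNReal.ofReal (F []) := by
  suffices H : ∀ t ≤ T,
      ∑' h, law A C prm hC g t h * ENNReal.ofReal (F h) ≤ ENNReal.ofReal (F []) from H T le_rfl
  intro t
  induction t with
  | zero =>
    intro _
    rw [tsum_eq_single []]
    · simp [law]
    · intro b hb
      simp [law, PMF.pure_apply, hb]
  | succ t ih =>
    intro ht
    refine le_trans ?_ (ih (by omega))
    rw [law, PMF.tsum_bind_mul]
    refine ENNReal.tsum_le_tsum fun h => ?_
    by_cases h0 : law A C prm hC g t h = 0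
    · simp [h0]
    have hlen := length_eq_of_law_ne_zero A C prm hC g t h h0
    gcongr
    have hs := sampleProb_nonneg A C prm (weights_pos A C prm g h)
    rw [PMF.tsum_map_mul, tsum_fintype]
    refine le_trans (le_of_eq ?_) (ENNReal.ofReal_le_ofReal (hF h (by omega)))
    rw [ENNReal.ofReal_sum_of_nonneg fun π _ => mul_nonneg (hs π) (hF0 _)]
    refine Finset.sum_congr rfl fun π _ => ?_
    rw [ENNReal.ofReal_mul (hs π)]
    rfl

end CDSB

/-! ### One-round estimates -/

/-- No lower bound on `x` is required, which matters below: the importance-weighted deviation can be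
very negative when the flow is small. -/
theorem Real.exp_le_one_add_add_sq {x : ℝ} (hx : x ≤ 1) : Real.exp x ≤ 1 + x + x ^ 2 := by
  rcases le_total (-1) x with h | h
  · have := (abs_le.1 (Real.abs_exp_sub_one_sub_id_le (abs_le.2 ⟨h, hx⟩))).2
    linarith
  · have : Real.exp x ≤ 1 := Real.exp_le_one_iff.2 (by linarith)
    nlinarith

open scoped Classical in
theorem PathAutomaton.AcceptingPath.sum_map_eq {Q X : Type*} [Fintype X] {A : PathAutomaton Q X}
    (π : A.AcceptingPath) (f : X → ℝ) :
    (π.1.map f).sum = ∑ e, if e ∈ π.1 then f e else 0 := by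
  rw [← List.sum_toFinset f (PathAutomaton.AcceptingPath.nodup π), ← Finset.sum_filter]
  refine Finset.sum_congr ?_ fun _ _ => rfl
  ext e
  simp

theorem PathAutomaton.AcceptingPath.sum_map_le {Q X : Type*} [Finite X] {A : PathAutomaton Q X}
    (π : A.AcceptingPath) {f : X → ℝ} {b : ℝ} (hb : 0 ≤ b) (hf : ∀ e, f e ≤ b) :
    (π.1.map f).sum ≤ A.longestPath * b := by
  have h1 : (π.1.map f).sum ≤ π.1.length * b := by
    have := List.sum_le_card_nsmul (π.1.map f) b (by simpa using fun e _ => hf e)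
    simpa using this
  refine h1.trans (mul_le_mul_of_nonneg_right ?_ hb)
  exact_mod_cast PathAutomaton.AcceptingPath.length_le_longestPath π

theorem List.sum_map_sq_le {α : Type*} (l : List α) (f : α → ℝ) :
    (l.map f).sum ^ 2 ≤ l.length * (l.map fun a => f a ^ 2).sum := by
  have h := sq_sum_le_card_mul_sum_sq (s := Finset.univ) (f := fun i : Fin l.length => f (l.get i))
  have e : ∀ k : α → ℝ, ∑ i : Fin l.length, k (l.get i) = (l.map k).sum := fun k => by
    rw [← List.sum_ofFn]
    congr 1
    exact List.ext_getElem (by simp) (by simp)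
  rw [e f, e fun a => f a ^ 2] at h
  simpa using h

theorem List.prod_map_mul_exp {α : Type*} (l : List α) (w f : α → ℝ) :
    (l.map fun a => w a * Real.exp (f a)).prod = (l.map w).prod * Real.exp (l.map f).sum := by
  rw [List.prod_map_mul, Real.exp_list_sum, List.map_map]
  rfl

namespace CDSB

variable {Q X : Type*} [Fintype X] {A : PathAutomaton Q X} {C : Finset A.AcceptingPath}
  {prm : CDSBParams} {w : X → ℝ}

theorem pathProb_nonneg (hw : ∀ e, 0 < w e) (π : A.AcceptingPath) : 0 ≤ pathProb A w π :=
  div_nonneg (prod_map_pos hw _).le (Finset.sum_nonneg fun _ _ => (prod_map_pos hw _).le)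

/-- A single covering path through `e` already receives mass γ/|C| from the exploration part of the
sampling distribution. -/
theorem div_card_le_flow (hcover : A.Covers C) (hw : ∀ e, 0 < w e) (e : X) :
    prm.γ / C.card ≤ flow A C prm w e := by
  classical
  obtain ⟨π, hπ, he⟩ := hcover e
  have h := Finset.single_le_sum (f := fun π : A.AcceptingPath =>
    if e ∈ π.1 then sampleProb A C prm w π else 0) (fun ρ _ => by
      split_ifs
      exacts [sampleProb_nonneg A C prm hw ρ, le_rfl]) (Finset.mem_univ π)
  refine le_trans ?_ (h.trans (le_of_eq (Finset.sum_congr rfl fun _ _ => by congr)))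
  have h1 := mul_nonneg (sub_nonneg.2 prm.γ_le_one) (pathProb_nonneg hw π)
  simp only [he, if_true, sampleProb, coverProb, hπ]
  rw [mul_one_div]
  linarith

theorem flow_pos (hC : C.Nonempty) (hcover : A.Covers C) (hw : ∀ e, 0 < w e) (e : X) :
    0 < flow A C prm w e :=
  (div_pos prm.γ_pos (by exact_mod_cast hC.card_pos)).trans_le (div_card_le_flow hcover hw e)

theorem sum_sampleProb_mul_sum_map (f : X → ℝ) :
    ∑ π : A.AcceptingPath, sampleProb A C prm w π * (π.1.map f).sum =
      ∑ e, flow A C prm w e * f e := by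
  classical
  simp only [PathAutomaton.AcceptingPath.sum_map_eq, Finset.mul_sum, flow, Finset.sum_mul]
  rw [Finset.sum_comm]
  refine Finset.sum_congr rfl fun e _ => Finset.sum_congr rfl fun π _ => ?_
  by_cases h : e ∈ π.1 <;> simp [h]

open scoped Classical in
theorem flow_mul_surrogateGain (hq : ∀ e, 0 < flow A C prm w e) (g : X → ℝ)
    (π : A.AcceptingPath) (e : X) :
    flow A C prm w e * surrogateGain A C prm w g π e =
      (if e ∈ π.1 then g e else 0) + prm.β := by
  have := (hq e).ne'
  unfold surrogateGain
  split_ifs <;> field_simp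
  ring

theorem surrogateGain_nonneg (hq : ∀ e, 0 < flow A C prm w e) {g : X → ℝ} (hg : ∀ e, 0 ≤ g e)
    (π : A.AcceptingPath) (e : X) : 0 ≤ surrogateGain A C prm w g π e := by
  have h1 := hq e
  have h2 := hg e
  have h3 := prm.β_pos
  unfold surrogateGain
  split_ifs <;> positivity

theorem surrogateGain_le (hq : ∀ e, 0 < flow A C prm w e) {g : X → ℝ} (hg : ∀ e, 0 ≤ g e) {B : ℝ}
    (hgB : ∀ e, g e ≤ B) (hβ : prm.β ≤ B) (π : A.AcceptingPath) (e : X) :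
    surrogateGain A C prm w g π e ≤ 2 * B / flow A C prm w e := by
  have h1 := hq e
  have h2 := hg e
  have h3 := hgB e
  have h4 := prm.β_pos
  unfold surrogateGain
  split_ifs <;> gcongr <;> linarith

/-- With confidence term `β / q`, the surrogate gains overestimate the gains: the exponential
moment of the scaled difference is at most `1`. -/
theorem sum_sampleProb_mul_exp_le (hC : C.Nonempty) (hcover : A.Covers C) (hw : ∀ e, 0 < w e)
    {g : X → ℝ} (hg : ∀ e, 0 ≤ g e) {B : ℝ} (hB : 0 < B) (hgB : ∀ e, g e ≤ B) (hβ : prm.β ≤ B)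
    (e : X) :
    ∑ π, sampleProb A C prm w π *
      Real.exp (prm.β / B ^ 2 * (g e - surrogateGain A C prm w g π e)) ≤ 1 := by
  classical
  set q := flow A C prm w e with hq_def
  have hq : 0 < q := flow_pos hC hcover hw e
  set c := prm.β / B ^ 2 with hc_def
  have hβ0 := prm.β_pos
  have hc : 0 < c := by positivity
  have hcβ : c * prm.β = (prm.β / B) ^ 2 := by rw [hc_def]; field_simp
  have hcg : c * g e ≤ prm.β / B := by
    have : c * g e ≤ c * B := by gcongr; exact hgB e
    refine this.trans (le_of_eq ?_)
    rw [hc_def]; field_simp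
  have hβB : prm.β / B ≤ 1 := (div_le_one hB).2 hβ
  have hcg0 : 0 ≤ c * g e := mul_nonneg hc.le (hg e)
  have hS := sum_sampleProb A C prm hC hw
  have hs := sampleProb_nonneg A C prm hw
  -- The exponent is the constant −cβ/q plus the variable x = cg − 1[e ∈ π] cg/q, which has mean
  -- zero and satisfies x ≤ 1; the bracket is 1 + x + x², expanded around the indicator.
  have hle : ∀ π : A.AcceptingPath,
      Real.exp (c * (g e - surrogateGain A C prm w g π e)) ≤
        Real.exp (-(c * prm.β / q)) *
          (1 + c * g e + (c * g e) ^ 2 +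
            (if e ∈ π.1 then (-(c * g e) / q - 2 * (c * g e) ^ 2 / q + (c * g e / q) ^ 2)
              else 0)) := by
    intro π
    have hx : c * (g e - surrogateGain A C prm w g π e) =
        -(c * prm.β / q) + (c * g e - if e ∈ π.1 then c * g e / q else 0) := by
      unfold surrogateGain
      rw [← hq_def]
      split_ifs <;> ring
    rw [hx, Real.exp_add]
    refine mul_le_mul_of_nonneg_left ?_ (Real.exp_pos _).le
    refine (Real.exp_le_one_add_add_sq ?_).trans (le_of_eq ?_)
    · split_ifs
      · have : 0 ≤ c * g e / q := by positivity
        linarith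
      · linarith
    · split_ifs <;> ring
  have hflow : ∑ π : A.AcceptingPath, sampleProb A C prm w π * (if e ∈ π.1 then
      (-(c * g e) / q - 2 * (c * g e) ^ 2 / q + (c * g e / q) ^ 2) else 0) =
      q * (-(c * g e) / q - 2 * (c * g e) ^ 2 / q + (c * g e / q) ^ 2) := by
    rw [hq_def, flow, Finset.sum_mul, ← flow, ← hq_def]
    refine Finset.sum_congr rfl fun π _ => ?_
    by_cases h : e ∈ π.1 <;> simp [h]
  calc _ ≤ ∑ π, sampleProb A C prm w π * (Real.exp (-(c * prm.β / q)) *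
          (1 + c * g e + (c * g e) ^ 2 +
            (if e ∈ π.1 then (-(c * g e) / q - 2 * (c * g e) ^ 2 / q + (c * g e / q) ^ 2)
              else 0))) :=
        Finset.sum_le_sum fun π _ => mul_le_mul_of_nonneg_left (hle π) (hs π)
    _ = Real.exp (-(c * prm.β / q)) * ((∑ π, sampleProb A C prm w π) *
          (1 + c * g e + (c * g e) ^ 2) + ∑ π : A.AcceptingPath, sampleProb A C prm w π *
            (if e ∈ π.1 then (-(c * g e) / q - 2 * (c * g e) ^ 2 / q + (c * g e / q) ^ 2)
              else 0)) := by
        rw [Finset.sum_mul, ← Finset.sum_add_distrib, Finset.mul_sum]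
        refine Finset.sum_congr rfl fun π _ => by ring
    _ = Real.exp (-(c * prm.β / q)) * (1 - (c * g e) ^ 2 + (c * g e) ^ 2 / q) := by
        rw [hflow, hS]
        congr 1
        field_simp
        ring
    _ ≤ Real.exp (-(c * prm.β / q)) * Real.exp (c * prm.β / q) := by
        refine mul_le_mul_of_nonneg_left ?_ (Real.exp_pos _).le
        -- The choice c = β/B² is made for this: the second moment of x is paid for by the
        -- confidence term.
        have h1 : (c * g e) ^ 2 / q ≤ c * prm.β / q := by
          rw [hcβ]
          gcongr
        have h2 := Real.add_one_le_exp (c * prm.β / q)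
        nlinarith [sq_nonneg (c * g e)]
    _ = 1 := by rw [← Real.exp_add]; simp

/-- The growth of the total weight of all paths in one round. -/
theorem sum_prod_map_le (hC : C.Nonempty) (hcover : A.Covers C) (hw : ∀ e, 0 < w e)
    {g : X → ℝ} (hg : ∀ e, 0 ≤ g e) {B : ℝ} (hB : 0 < B) (hgB : ∀ e, g e ≤ B) (hβ : prm.β ≤ B)
    (hη : 2 * prm.η * B * A.longestPath * C.card ≤ prm.γ) (hγ : prm.γ < 1)
    (π : A.AcceptingPath) :
    ∑ ρ : A.AcceptingPath,
        (ρ.1.map fun e => w e * Real.exp (prm.η * surrogateGain A C prm w g π e)).prod ≤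
      (∑ ρ : A.AcceptingPath, (ρ.1.map w).prod) *
        Real.exp ((prm.η * ((π.1.map g).sum + Fintype.card X * prm.β) +
          prm.η ^ 2 * (2 * B * A.longestPath * ∑ e, surrogateGain A C prm w g π e)) /
            (1 - prm.γ)) := by
  classical
  have hq := flow_pos (prm := prm) hC hcover hw
  set G := surrogateGain A C prm w g π with hG
  have hG0 : ∀ e, 0 ≤ G e := surrogateGain_nonneg hq hg π
  have hη0 := prm.η_pos
  have hγ0 := prm.γ_pos
  have hβ0 := prm.β_pos
  have hcard : (0 : ℝ) < C.card := by exact_mod_cast hC.card_pos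
  have hs := sampleProb_nonneg A C prm hw
  set Z := ∑ ρ : A.AcceptingPath, (ρ.1.map w).prod with hZ_def
  have hZ : 0 < Z :=
    Finset.sum_pos (fun ρ _ => prod_map_pos hw _) ⟨hC.choose, Finset.mem_univ _⟩
  have hqG : ∀ e, flow A C prm w e * G e ≤ 2 * B := fun e => by
    rw [hG, flow_mul_surrogateGain hq]
    split_ifs <;> linarith [hgB e]
  have hS0 : ∀ ρ : A.AcceptingPath, 0 ≤ (ρ.1.map G).sum := fun ρ =>
    List.sum_nonneg (by simpa using fun e _ => hG0 e)
  -- Exploration bounds each surrogate by 2B|C|/γ, and a path has at most K transitions; `hη` is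
  -- exactly what makes the product at most 1.
  have hle1 : ∀ ρ : A.AcceptingPath, prm.η * (ρ.1.map G).sum ≤ 1 := by
    intro ρ
    have h1 : ∀ e, G e ≤ 2 * B * C.card / prm.γ := fun e => by
      refine (surrogateGain_le hq hg hgB hβ π e).trans ?_
      rw [div_le_div_iff₀ (hq e) hγ0]
      have := (div_le_iff₀ hcard).1 (div_card_le_flow (prm := prm) hcover hw e)
      nlinarith
    have h2 := ρ.sum_map_le (by positivity) h1
    calc prm.η * (ρ.1.map G).sum ≤ prm.η * (A.longestPath * (2 * B * C.card / prm.γ)) := by gcongr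
      _ = 2 * prm.η * B * A.longestPath * C.card / prm.γ := by ring
      _ ≤ 1 := (div_le_one hγ0).2 hη
  -- Passing to the sampling distribution turns path moments into sums weighted by the flow, which
  -- cancels the denominators of the surrogates.
  have hp : ∀ ρ : A.AcceptingPath, pathProb A w ρ ≤ sampleProb A C prm w ρ / (1 - prm.γ) := by
    intro ρ
    rw [le_div_iff₀ (by linarith)]
    have : 0 ≤ coverProb A C ρ := by unfold coverProb; split_ifs <;> positivity
    unfold sampleProb
    nlinarith
  have hsum1 : ∑ ρ : A.AcceptingPath, sampleProb A C prm w ρ * (ρ.1.map G).sum =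
      (π.1.map g).sum + Fintype.card X * prm.β := by
    rw [sum_sampleProb_mul_sum_map, π.sum_map_eq]
    simp only [hG, flow_mul_surrogateGain hq, Finset.sum_add_distrib]
    simp
  -- Cauchy–Schwarz along the path costs a factor K; then q · G ≤ 2B removes one power of the
  -- surrogate.
  have hsum2 : ∑ ρ : A.AcceptingPath, sampleProb A C prm w ρ * (ρ.1.map G).sum ^ 2 ≤
      2 * B * A.longestPath * ∑ e, G e := by
    calc _ ≤ ∑ ρ : A.AcceptingPath, sampleProb A C prm w ρ *
          (A.longestPath * (ρ.1.map fun e => G e ^ 2).sum) := by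
          refine Finset.sum_le_sum fun ρ _ => mul_le_mul_of_nonneg_left ?_ (hs ρ)
          refine (List.sum_map_sq_le _ _).trans (mul_le_mul_of_nonneg_right ?_ ?_)
          · exact_mod_cast ρ.length_le_longestPath
          · exact List.sum_nonneg (by simpa using fun e _ => sq_nonneg (G e))
      _ = A.longestPath * ∑ e, flow A C prm w e * G e ^ 2 := by
          rw [← sum_sampleProb_mul_sum_map, Finset.mul_sum]
          exact Finset.sum_congr rfl fun ρ _ => by ring
      _ ≤ A.longestPath * ∑ e, 2 * B * G e := by
          refine mul_le_mul_of_nonneg_left (Finset.sum_le_sum fun e _ => ?_) (Nat.cast_nonneg _)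
          rw [sq, ← mul_assoc]
          exact mul_le_mul_of_nonneg_right (hqG e) (hG0 e)
      _ = _ := by rw [← Finset.mul_sum]; ring
  have hp1 : ∑ ρ : A.AcceptingPath, pathProb A w ρ = 1 := by
    simp only [pathProb]
    rw [← Finset.sum_div, div_self hZ.ne']
  calc _ = ∑ ρ : A.AcceptingPath, (ρ.1.map w).prod * Real.exp (prm.η * (ρ.1.map G).sum) := by
        refine Finset.sum_congr rfl fun ρ _ => ?_
        rw [List.prod_map_mul_exp, List.sum_map_mul_left]
    _ ≤ ∑ ρ : A.AcceptingPath, (ρ.1.map w).prod *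
          (1 + prm.η * (ρ.1.map G).sum + (prm.η * (ρ.1.map G).sum) ^ 2) :=
        Finset.sum_le_sum fun ρ _ => mul_le_mul_of_nonneg_left
          (Real.exp_le_one_add_add_sq (hle1 ρ)) (prod_map_pos hw _).le
    _ = Z * ∑ ρ : A.AcceptingPath, pathProb A w ρ *
          (1 + (prm.η * (ρ.1.map G).sum + (prm.η * (ρ.1.map G).sum) ^ 2)) := by
        rw [Finset.mul_sum]
        refine Finset.sum_congr rfl fun ρ _ => ?_
        rw [pathProb, ← hZ_def]
        field_simp
        ring
    _ = Z * (1 + ∑ ρ : A.AcceptingPath, pathProb A w ρ *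
          (prm.η * (ρ.1.map G).sum + (prm.η * (ρ.1.map G).sum) ^ 2)) := by
        simp only [mul_add (pathProb A w _) 1, Finset.sum_add_distrib, mul_one, hp1]
    _ ≤ Z * (1 + ∑ ρ : A.AcceptingPath, sampleProb A C prm w ρ / (1 - prm.γ) *
          (prm.η * (ρ.1.map G).sum + (prm.η * (ρ.1.map G).sum) ^ 2)) := by
        gcongr with ρ
        · have := hS0 ρ
          positivity
        · exact hp ρ
    _ = Z * (1 + (prm.η * (∑ ρ : A.AcceptingPath, sampleProb A C prm w ρ * (ρ.1.map G).sum) +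
          prm.η ^ 2 * ∑ ρ : A.AcceptingPath, sampleProb A C prm w ρ * (ρ.1.map G).sum ^ 2) /
            (1 - prm.γ)) := by
        congr 2
        rw [Finset.mul_sum, Finset.mul_sum, ← Finset.sum_add_distrib, Finset.sum_div]
        exact Finset.sum_congr rfl fun ρ _ => by ring
    _ ≤ Z * (1 + (prm.η * ((π.1.map g).sum + Fintype.card X * prm.β) +
          prm.η ^ 2 * (2 * B * A.longestPath * ∑ e, G e)) / (1 - prm.γ)) := by
        rw [hsum1]
        have : 0 < 1 - prm.γ := by linarith
        gcongr
    _ ≤ _ := by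
        gcongr
        linarith [Real.add_one_le_exp ((prm.η * ((π.1.map g).sum + Fintype.card X * prm.β) +
          prm.η ^ 2 * (2 * B * A.longestPath * ∑ e, G e)) / (1 - prm.γ))]

end CDSB

/-! ### Summation over the rounds: regret and concentration -/

/-- The sum over the rounds of a history of the quantity `f h π`, where `π` was sampled in the
round that follows `h`. -/
noncomputable def cumulative {Ω : Type*} (f : List Ω → Ω → ℝ) : List Ω → ℝ
  | [] => 0
  | π :: h => cumulative f h + f h π

theorem cumulative_nonneg {Ω : Type*} {f : List Ω → Ω → ℝ} {T : ℕ}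
    (hf : ∀ h, h.length < T → ∀ π, 0 ≤ f h π) :
    ∀ h : List Ω, h.length ≤ T → 0 ≤ cumulative f h
  | [], _ => le_rfl
  | π :: h, hh => by
    simp only [List.length_cons] at hh
    exact add_nonneg (cumulative_nonneg hf h (by omega)) (hf h (by omega) π)

theorem cumulative_le {Ω : Type*} {f : List Ω → Ω → ℝ} {T : ℕ} {b : ℝ}
    (hf : ∀ h, h.length < T → ∀ π, f h π ≤ b) :
    ∀ h : List Ω, h.length ≤ T → cumulative f h ≤ h.length * b
  | [], _ => by simp [cumulative]
  | π :: h, hh => by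
    simp only [List.length_cons] at hh
    have h1 := cumulative_le hf h (by omega)
    have h2 := hf h (by omega) π
    simp only [cumulative, List.length_cons]
    push_cast
    linarith

theorem cumulative_sub {Ω : Type*} (f k : List Ω → Ω → ℝ) :
    ∀ h : List Ω, cumulative (fun h π => f h π - k h π) h = cumulative f h - cumulative k h
  | [] => by simp [cumulative]
  | π :: h => by
    simp only [cumulative, cumulative_sub f k h]
    ring

theorem cumulative_sum_map {Ω X : Type*} (f : X → List Ω → Ω → ℝ) (l : List X) :
    ∀ h : List Ω, cumulative (fun h π => (l.map fun e => f e h π).sum) h =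
      (l.map fun e => cumulative (f e) h).sum
  | [] => by simp [cumulative]
  | π :: h => by simp [cumulative, cumulative_sum_map f l h, List.sum_map_add]

namespace CDSB

variable {Q X : Type*} [Fintype X] {A : PathAutomaton Q X} {C : Finset A.AcceptingPath}
  {prm : CDSBParams} {g : List A.AcceptingPath → X → ℝ}

variable (A C prm g) in
/-- The cumulative surrogate gain of the transition `e`. -/
noncomputable def cumulativeSurrogate (e : X) : List A.AcceptingPath → ℝ :=
  cumulative fun h π => surrogateGain A C prm (weights A C prm g h) (g h) π e

theorem weights_eq_exp (h : List A.AcceptingPath) (e : X) :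
    weights A C prm g h e = Real.exp (prm.η * cumulativeSurrogate A C prm g e h) := by
  induction h with
  | nil => simp [weights, cumulativeSurrogate, cumulative]
  | cons π h ih =>
    simp only [weights, ih, cumulativeSurrogate, cumulative, mul_add, Real.exp_add]

variable {T : ℕ} {B : ℝ}

/-- Telescopes `sum_prod_map_le`; the initial total weight is the number of paths, since all weights
start at 1. -/
theorem sum_prod_weights_le (hC : C.Nonempty) (hcover : A.Covers C)
    (hg : ∀ h, h.length < T → ∀ e, 0 ≤ g h e) (hB : 0 < B)
    (hgB : ∀ h, h.length < T → ∀ e, g h e ≤ B) (hβ : prm.β ≤ B)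
    (hη : 2 * prm.η * B * A.longestPath * C.card ≤ prm.γ) (hγ : prm.γ < 1)
    (h : List A.AcceptingPath) (hh : h.length ≤ T) :
    ∑ ρ : A.AcceptingPath, (ρ.1.map (weights A C prm g h)).prod ≤
      A.numPaths * Real.exp ((prm.η * (cumulative (fun h π => (π.1.map (g h)).sum) h +
          h.length * Fintype.card X * prm.β) +
        prm.η ^ 2 * (2 * B * A.longestPath * ∑ e, cumulativeSurrogate A C prm g e h)) /
          (1 - prm.γ)) := by
  induction h with
  | nil =>
    have h1 : weights A C prm g [] = fun _ => 1 := rfl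
    simp [h1, cumulativeSurrogate, cumulative, PathAutomaton.numPaths, Nat.card_eq_fintype_card]
  | cons π h ih =>
    simp only [List.length_cons] at hh
    have h1 := sum_prod_map_le hC hcover (weights_pos A C prm g h) (hg h (by omega)) hB
      (hgB h (by omega)) hβ hη hγ π
    refine h1.trans ((mul_le_mul_of_nonneg_right (ih (by omega)) (Real.exp_pos _).le).trans
      (le_of_eq ?_))
    rw [mul_assoc, ← Real.exp_add]
    congr 2
    rw [← add_div]
    congr 1
    simp only [cumulativeSurrogate, cumulative, Finset.sum_add_distrib, List.length_cons]
    push_cast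
    ring

theorem cumulativeSurrogate_nonneg (hC : C.Nonempty) (hcover : A.Covers C)
    (hg : ∀ h, h.length < T → ∀ e, 0 ≤ g h e) (e : X)
    (h : List A.AcceptingPath) (hh : h.length ≤ T) : 0 ≤ cumulativeSurrogate A C prm g e h :=
  cumulative_nonneg (fun h hlt π => surrogateGain_nonneg
    (flow_pos hC hcover (weights_pos A C prm g h)) (hg h hlt) π e) h hh

/-- The regret bound on the event that the surrogate gains do not underestimate the gains by more
than `R`. -/
theorem regret_le (hC : C.Nonempty) (hcover : A.Covers C)
    (hg : ∀ h, h.length < T → ∀ e, 0 ≤ g h e) (hB : 0 < B)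
    (hgB : ∀ h, h.length < T → ∀ e, g h e ≤ B) (hβ : prm.β ≤ B)
    (hη : 2 * prm.η * B * A.longestPath * C.card ≤ prm.γ) (hγ : prm.γ ≤ 1 / 2)
    (h : List A.AcceptingPath) (hh : h.length = T) {R : ℝ} (hR : 0 ≤ R)
    (hconc : ∀ e, cumulative (fun h _ => g h e) h - cumulativeSurrogate A C prm g e h ≤ R)
    (π₀ : A.AcceptingPath) :
    cumulative (fun h π => (π₀.1.map (g h)).sum - (π.1.map (g h)).sum) h ≤
      2 * prm.γ * (T * (A.longestPath * B)) + A.longestPath * R +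
        Real.log A.numPaths / prm.η + T * Fintype.card X * prm.β := by
  set S : X → ℝ := fun e => cumulativeSurrogate A C prm g e h with hS
  have hS0 : ∀ e, 0 ≤ S e := fun e => cumulativeSurrogate_nonneg hC hcover hg e h hh.le
  have hη0 := prm.η_pos
  have hγ0 := prm.γ_pos
  -- The comparison uses the best surrogate path rather than `π₀`, because the second-order error
  -- involves all transitions and only the maximum over paths controls it.
  obtain ⟨ρ, -, hρ⟩ := Finset.exists_max_image (Finset.univ : Finset A.AcceptingPath)
    (fun ρ => (ρ.1.map S).sum) ⟨π₀, Finset.mem_univ _⟩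
  set V := (ρ.1.map S).sum with hV
  set Γ := cumulative (fun h π => (π.1.map (g h)).sum) h with hΓ
  have hV0 : 0 ≤ V := List.sum_nonneg (by simpa using fun e _ => hS0 e)
  have hsumS : ∑ e, S e ≤ C.card * V := by
    classical
    calc ∑ e, S e ≤ ∑ e, ∑ π ∈ C, (if e ∈ π.1 then S e else 0) := by
          refine Finset.sum_le_sum fun e _ => ?_
          obtain ⟨π, hπ, he⟩ := hcover e
          have := Finset.single_le_sum (f := fun π : A.AcceptingPath => if e ∈ π.1 then S e else 0)
            (fun ρ _ => by split_ifs; exacts [hS0 e, le_rfl]) hπ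
          simpa [he] using this
      _ = ∑ π ∈ C, (π.1.map S).sum := by
          rw [Finset.sum_comm]
          refine Finset.sum_congr rfl fun π _ => ?_
          rw [π.sum_map_eq]
      _ ≤ ∑ π ∈ C, V := Finset.sum_le_sum fun π _ => hρ π (Finset.mem_univ _)
      _ = C.card * V := by simp
  have hup := sum_prod_weights_le hC hcover hg hB hgB hβ hη (by linarith) h hh.le
  have hlow : Real.exp (prm.η * V) ≤
      ∑ ρ : A.AcceptingPath, (ρ.1.map (weights A C prm g h)).prod := by
    have h1 := Finset.single_le_sum
      (f := fun ρ : A.AcceptingPath => (ρ.1.map (weights A C prm g h)).prod)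
      (fun ρ _ => (prod_map_pos (weights_pos A C prm g h) _).le) (Finset.mem_univ ρ)
    refine (le_of_eq ?_).trans h1
    have h2 := List.prod_map_mul_exp ρ.1 (fun _ => (1 : ℝ)) (fun e => prm.η * S e)
    simp only [one_mul, List.map_const', List.prod_replicate, one_pow,
      List.sum_map_mul_left] at h2
    simp only [funext (weights_eq_exp (A := A) (C := C) (prm := prm) (g := g) h), hV]
    exact h2.symm
  have hN : (0 : ℝ) < A.numPaths := by
    have : Nonempty A.AcceptingPath := ⟨π₀⟩
    exact_mod_cast Nat.card_pos
  have hlog := Real.log_le_log (Real.exp_pos _) (hlow.trans hup)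
  rw [Real.log_exp, Real.log_mul hN.ne' (Real.exp_pos _).ne', Real.log_exp, hh] at hlog
  have hlogN : 0 ≤ Real.log A.numPaths := Real.log_natCast_nonneg _
  have h1γ : 0 < 1 - prm.γ := by linarith
  have hmain : (1 - 2 * prm.γ) * V ≤
      Real.log A.numPaths / prm.η + Γ + T * Fintype.card X * prm.β := by
    have e1 : (1 - prm.γ) * (prm.η * V) ≤ (1 - prm.γ) * Real.log A.numPaths +
        (prm.η * (Γ + T * Fintype.card X * prm.β) +
          prm.η ^ 2 * (2 * B * A.longestPath * ∑ e, S e)) := by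
      refine (mul_le_mul_of_nonneg_left hlog h1γ.le).trans (le_of_eq ?_)
      rw [mul_add, mul_div_cancel₀ _ h1γ.ne']
    -- By `hsumS` and `hη` the second-order error is at most a fraction γ of the main term and is
    -- absorbed on the left, giving the factor 1 − 2γ.
    have e2 : prm.η ^ 2 * (2 * B * A.longestPath * ∑ e, S e) ≤ prm.η * (prm.γ * V) := by
      calc prm.η ^ 2 * (2 * B * A.longestPath * ∑ e, S e)
          ≤ prm.η ^ 2 * (2 * B * A.longestPath * (C.card * V)) := by gcongr
        _ = prm.η * (2 * prm.η * B * A.longestPath * C.card * V) := by ring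
        _ ≤ _ := by gcongr
    have e3 : (1 - prm.γ) * Real.log A.numPaths ≤ Real.log A.numPaths := by nlinarith
    have e4 : prm.η * ((1 - 2 * prm.γ) * V) ≤ prm.η *
        (Real.log A.numPaths / prm.η + Γ + T * Fintype.card X * prm.β) := by
      have : prm.η * (Real.log A.numPaths / prm.η) = Real.log A.numPaths := by field_simp
      linarith
    exact le_of_mul_le_mul_left e4 hη0
  set D := cumulative (fun h _ => (π₀.1.map (g h)).sum) h with hD
  have hDV : D - A.longestPath * R ≤ V := by
    have e1 : D = (π₀.1.map fun e => cumulative (fun h _ => g h e) h).sum :=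
      cumulative_sum_map (fun e h _ => g h e) π₀.1 h
    have e2 := π₀.sum_map_le hR hconc
    have e3 := hρ π₀ (Finset.mem_univ _)
    have e4 : (π₀.1.map fun e => cumulative (fun h _ => g h e) h).sum =
        (π₀.1.map fun e => cumulative (fun h _ => g h e) h - S e).sum + (π₀.1.map S).sum := by
      rw [← List.sum_map_add]
      simp
    linarith
  have hDle : D ≤ T * (A.longestPath * B) := by
    have := cumulative_le (f := fun h _ => (π₀.1.map (g h)).sum) (T := T)
      (fun h hlt _ => π₀.sum_map_le hB.le (hgB h hlt)) h hh.le
    rwa [hh] at this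
  rw [cumulative_sub]
  have hKR : 0 ≤ A.longestPath * R := by positivity
  have f1 : (1 - 2 * prm.γ) * (D - A.longestPath * R) ≤ (1 - 2 * prm.γ) * V :=
    mul_le_mul_of_nonneg_left hDV (by linarith)
  have f2 : 2 * prm.γ * D ≤ 2 * prm.γ * (T * (A.longestPath * B)) := by gcongr
  nlinarith [mul_nonneg hγ0.le hKR]

/-- With probability at least `1 - δ`, no surrogate gain underestimates the cumulative gain by more
than `B ^ 2 / β * log (M / δ)`. -/
theorem one_sub_le_law (hC : C.Nonempty) (hcover : A.Covers C)
    (hg : ∀ h, h.length < T → ∀ e, 0 ≤ g h e) (hB : 0 < B)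
    (hgB : ∀ h, h.length < T → ∀ e, g h e ≤ B) (hβ : prm.β ≤ B) [Nonempty X]
    {δ : ℝ} (hδ0 : 0 < δ) (S : Set (List A.AcceptingPath))
    (hS : ∀ h : List A.AcceptingPath, h.length = T →
      (∀ e, cumulative (fun h _ => g h e) h - cumulativeSurrogate A C prm g e h ≤
        B ^ 2 / prm.β * Real.log (Fintype.card X / δ)) → h ∈ S) :
    ENNReal.ofReal (1 - δ) ≤ (law A C prm hC g T).toOuterMeasure S := by
  have hβ0 := prm.β_pos
  set c := prm.β / B ^ 2 with hc
  have hc0 : 0 < c := by positivity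
  have hM : (0 : ℝ) < Fintype.card X := by exact_mod_cast Fintype.card_pos
  set D : X → List A.AcceptingPath → ℝ := fun e h =>
    cumulative (fun h _ => g h e) h - cumulativeSurrogate A C prm g e h with hD
  -- Normalised so that `F [] = δ`, while `F h < 1` forces every summand below M/δ, hence the
  -- required bound for every transition.
  set F : List A.AcceptingPath → ℝ := fun h =>
    δ / Fintype.card X * ∑ e, Real.exp (c * D e h) with hF
  have hF0 : ∀ h, 0 ≤ F h := fun h => by positivity
  have hstep := tsum_law_mul_le A C prm hC g T F hF0 (fun h hlt => by
    have hw := weights_pos A C prm g h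
    have hD' : ∀ e π, D e (π :: h) = D e h +
        (g h e - surrogateGain A C prm (weights A C prm g h) (g h) π e) := fun e π => by
      simp only [hD, cumulativeSurrogate, cumulative]
      ring
    calc ∑ π, sampleProb A C prm (weights A C prm g h) π * F (π :: h)
        = δ / Fintype.card X * ∑ e, Real.exp (c * D e h) *
            ∑ π, sampleProb A C prm (weights A C prm g h) π *
              Real.exp (c * (g h e - surrogateGain A C prm (weights A C prm g h) (g h) π e)) := by
          simp only [hF, hD', mul_add c, Real.exp_add, Finset.mul_sum]
          rw [Finset.sum_comm]
          exact Finset.sum_congr rfl fun e _ => Finset.sum_congr rfl fun π _ => by ring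
      _ ≤ δ / Fintype.card X * ∑ e, Real.exp (c * D e h) * 1 := by
          refine mul_le_mul_of_nonneg_left (Finset.sum_le_sum fun e _ => ?_) (by positivity)
          exact mul_le_mul_of_nonneg_left (sum_sampleProb_mul_exp_le hC hcover hw (hg h hlt) hB
            (hgB h hlt) hβ e) (Real.exp_pos _).le
      _ = F h := by simp [hF])
  have hFnil : F [] = δ := by
    simp only [hF, hD, cumulativeSurrogate, cumulative]
    simp [hM.ne']
  rw [hFnil] at hstep
  rw [ENNReal.ofReal_sub _ hδ0.le, ENNReal.ofReal_one]
  refine PMF.one_sub_le_toOuterMeasure _ _ S hstep fun h hne hnot => ?_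
  have hlen := length_eq_of_law_ne_zero A C prm hC g T h hne
  rw [ENNReal.one_le_ofReal]
  by_contra! hlt
  refine hnot (hS h hlen fun e => ?_)
  have h1 : Real.exp (c * D e h) ≤ ∑ e, Real.exp (c * D e h) :=
    Finset.single_le_sum (f := fun e => Real.exp (c * D e h)) (fun e _ => (Real.exp_pos _).le)
      (Finset.mem_univ e)
  have h2 : δ / Fintype.card X * Real.exp (c * D e h) < 1 :=
    (mul_le_mul_of_nonneg_left h1 (by positivity)).trans_lt hlt
  have h3 : Real.exp (c * D e h) ≤ Fintype.card X / δ := by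
    rw [le_div_iff₀ hδ0]
    rw [div_mul_eq_mul_div, div_lt_one hM] at h2
    linarith
  have h4 : c * D e h ≤ Real.log (Fintype.card X / δ) :=
    (Real.le_log_iff_exp_le (by positivity)).2 h3
  calc D e h = B ^ 2 / prm.β * (c * D e h) := by rw [hc]; field_simp
    _ ≤ _ := by gcongr

theorem ofReal_one_sub_le_law_of_forall (hC : C.Nonempty) {δ : ℝ} (hδ0 : 0 < δ)
    (S : Set (List A.AcceptingPath)) (hS : ∀ h : List A.AcceptingPath, h.length = T → h ∈ S) :
    ENNReal.ofReal (1 - δ) ≤ (law A C prm hC g T).toOuterMeasure S := by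
  have : (law A C prm hC g T).toOuterMeasure S = 1 :=
    (PMF.toOuterMeasure_apply_eq_one_iff _ _).2 fun h hh =>
      hS h (length_eq_of_law_ne_zero A C prm hC g T h ((PMF.mem_support_iff _ _).1 hh))
  rw [this, ENNReal.ofReal_le_one]
  linarith

end CDSB

/-! ### Tuning the parameters and the final bound -/

theorem cumulativeRegret_eq_cumulative {Q E Q' X Sym : Type*} {A : PathAutomaton Q E}
    {P : Finset (List Sym)} {A' : PathAutomaton Q' X} {lab : X → List E}
    (out : List A'.AcceptingPath → E → Sym) (y : List A'.AcceptingPath → List Sym)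
    {σ : A'.AcceptingPath → A.AcceptingPath} (hσ : ∀ π', A.Corresponds P A' lab (σ π') π')
    {π : A.AcceptingPath} {π' : A'.AcceptingPath} (hπ : A.Corresponds P A' lab π π') :
    ∀ h, cumulativeRegret P out y (fun π' => (σ π').1) π.1 h =
      cumulative (fun h ρ => (π'.1.map fun e => transitionGain P (out h) (y h) (lab e)).sum -
        (ρ.1.map fun e => transitionGain P (out h) (y h) (lab e)).sum) h
  | [] => rfl
  | ρ :: h => by
    simp only [cumulativeRegret, cumulative, cumulativeRegret_eq_cumulative out y hσ hπ h,
      hπ.countGain_eq, (hσ ρ).countGain_eq]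

theorem sqrt_mul_add_sqrt (B T K M c n l : ℝ) (hT : 0 ≤ T) (hK : 0 ≤ K) :
    2 * B * √(T * K) * (√(4 * K * c * n) + √(M * l)) =
      2 * B * (√(4 * T * K ^ 2 * c * n) + √(T * K * M * l)) := by
  have h1 : √(T * K) * √(4 * K * c * n) = √(4 * T * K ^ 2 * c * n) := by
    rw [← Real.sqrt_mul (by positivity)]
    ring_nf
  have h2 : √(T * K) * √(M * l) = √(T * K * M * l) := by
    rw [← Real.sqrt_mul (by positivity)]
    ring_nf
  rw [← h1, ← h2]
  ring

/-- Write a and b for the two square roots on the right. The parameters make the exploration and ln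
N terms both equal to Ba, and the deviation and bias terms both equal to Bb. The assumptions on T
give γ ≤ 1/2 and β ≤ B. -/
theorem CDSB.exists_params {B T K M c n l : ℝ} (hB : 0 < B) (hT : 0 < T) (hK : 0 < K)
    (hKM : K ≤ M) (hc : 0 < c) (hn : 0 < n) (hl : 0 < l) (hT1 : 16 * c * n < T)
    (hT2 : 4 * M * l < T * K) :
    ∃ prm : CDSBParams, prm.β ≤ B ∧ 2 * prm.η * B * K * c ≤ prm.γ ∧ prm.γ ≤ 1 / 2 ∧
      2 * prm.γ * (T * (K * B)) + K * (B ^ 2 / prm.β * l) + n / prm.η + T * M * prm.β =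
        2 * B * (√(4 * T * K ^ 2 * c * n) + √(T * K * M * l)) := by
  have hM : 0 < M := hK.trans_le hKM
  set a := √(4 * T * K ^ 2 * c * n) with ha_def
  set b := √(T * K * M * l) with hb_def
  have ha : 0 < a := Real.sqrt_pos.2 (by positivity)
  have hb : 0 < b := Real.sqrt_pos.2 (by positivity)
  have ha2 : a ^ 2 = 4 * T * K ^ 2 * c * n := Real.sq_sqrt (by positivity)
  have hb2 : b ^ 2 = T * K * M * l := Real.sq_sqrt (by positivity)
  have hγ : 2 * n * K * c / a ≤ 1 / 2 := by
    rw [div_le_iff₀ ha]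
    have : 4 * n * K * c ≤ a := by
      refine Real.le_sqrt_of_sq_le ?_
      calc (4 * n * K * c) ^ 2 = 16 * c * n * (n * K ^ 2 * c) := by ring
        _ ≤ T * (n * K ^ 2 * c) := by gcongr
        _ ≤ 4 * T * K ^ 2 * c * n := by
          have : 0 < T * (n * K ^ 2 * c) := by positivity
          linarith
    linarith
  have hβ : B * b / (T * M) ≤ B := by
    rw [div_le_iff₀ (by positivity)]
    refine mul_le_mul_of_nonneg_left ((Real.sqrt_le_left (by positivity)).2 ?_) hB.le
    have h1 : K * l ≤ T * M := by nlinarith [mul_pos hT hM, mul_pos hM hl, mul_pos hT hK]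
    calc T * K * M * l = T * M * (K * l) := by ring
      _ ≤ T * M * (T * M) := by gcongr
      _ = (T * M) ^ 2 := by ring
  refine ⟨⟨n / (B * a), B * b / (T * M), 2 * n * K * c / a, by positivity, by positivity,
    by positivity, by linarith⟩, hβ, le_of_eq ?_, hγ, ?_⟩
  · field_simp
  · have e1 : 2 * (2 * n * K * c / a) * (T * (K * B)) = B * a := by
      field_simp
      linear_combination -ha2
    have e2 : K * (B ^ 2 / (B * b / (T * M)) * l) = B * b := by
      field_simp
      linear_combination -hb2
    have e3 : n / (n / (B * a)) = B * a := by field_simp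
    have e4 : T * M * (B * b / (T * M)) = B * b := by field_simp
    simp only [e1, e2, e3, e4]
    ring

theorem mainTheorem5 {Q E Q' X Sym : Type*} [Fintype E] [Fintype X]
    -- the expert automaton, the patterns, and the context-dependent automaton
    (A : PathAutomaton Q E) (P : Finset (List Sym)) (hP : ∀ θ ∈ P, θ ≠ [])
    (A' : PathAutomaton Q' X) (lab : X → List E) (hA' : A.IsContextAutomaton P A' lab)
    -- a set of covering paths of the context-dependent automaton
    (C : Finset A'.AcceptingPath) (hC : C.Nonempty) (hcover : A'.Covers C)
    -- horizon, bound on the transition gains, confidence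
    (T : ℕ) (B : ℝ) (δ : ℝ) (hδ0 : 0 < δ) (hδ1 : δ < 1) :
    ∃ prm : CDSBParams,
      -- outputs and targets of each round may depend on the paths sampled before that round
      ∀ (out : List A'.AcceptingPath → E → Sym) (y : List A'.AcceptingPath → List Sym),
        (∀ h : List A'.AcceptingPath, h.length < T → ∀ e : X,
          transitionGain P (out h) (y h) (lab e) ≤ B) →
        -- the path expert used for prediction when a path of the automaton `A'` is sampled
        ∀ σ : A'.AcceptingPath → A.AcceptingPath,
          (∀ π', A.Corresponds P A' lab (σ π') π') →
          ENNReal.ofReal (1 - δ) ≤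
            (CDSB.law A' C prm hC
              (fun h e => transitionGain P (out h) (y h) (lab e)) T).toOuterMeasure
              {h | ∀ π : A.AcceptingPath,
                cumulativeRegret P out y (fun π' => (σ π').1) π.1 h ≤
                  2 * B * √(T * A'.longestPath) *
                    (√(4 * A'.longestPath * C.card * Real.log A.numPaths) +
                      √(Fintype.card X * Real.log (Fintype.card X / δ)))} := by
  classical
  set M : ℝ := (Fintype.card X : ℝ) with hM_def
  set K : ℝ := (A'.longestPath : ℝ) with hK_def
  set n : ℝ := Real.log A.numPaths with hn_def
  set l : ℝ := Real.log (M / δ) with hl_def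
  set c : ℝ := (C.card : ℝ) with hc_def
  have hK0 : 0 ≤ K := Nat.cast_nonneg _
  have hT0 : (0 : ℝ) ≤ T := Nat.cast_nonneg _
  have hc : 0 < c := Nat.cast_pos.2 hC.card_pos
  rw [sqrt_mul_add_sqrt B T K M c n l hT0 hK0]
  set a := √(4 * T * K ^ 2 * c * n) with ha_def
  set b := √(T * K * M * l) with hb_def
  have ha : 0 ≤ a := Real.sqrt_nonneg _
  have hb : 0 ≤ b := Real.sqrt_nonneg _
  -- In the degenerate and short-horizon cases the bound holds for every history of length T, so the
  -- parameters are arbitrary.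
  by_cases hmain : T = 0 ∨ IsEmpty X ∨ B ≤ 0 ∨ A.numPaths ≤ 1 ∨ T ≤ 16 * c * n ∨
      T * K ≤ 4 * M * l
  · refine ⟨⟨1, 1, 1, one_pos, one_pos, one_pos, le_rfl⟩, fun out y hgB σ hσ =>
      CDSB.ofReal_one_sub_le_law_of_forall hC hδ0 _ fun h hlen π => ?_⟩
    obtain ⟨π', hπ⟩ := hA'.exists_corresponds π
    rw [cumulativeRegret_eq_cumulative out y hσ hπ]
    rcases Nat.eq_zero_or_pos T with hT | hT
    · obtain rfl : h = [] := List.length_eq_zero_iff.1 (hlen.trans hT)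
      simp [cumulative, ha_def, hb_def, hT]
    have hgain : ∀ h e, 0 ≤ transitionGain P (out h) (y h) (lab e) :=
      fun h e => transitionGain_nonneg _ _ _ _
    rcases isEmpty_or_nonempty X with hX | ⟨⟨e₀⟩⟩
    · have hnil : ∀ ρ : A'.AcceptingPath, ρ.1 = [] := fun ρ => List.eq_nil_iff_forall_not_mem.2
        fun e => (hX.false e).elim
      have hKz : K = 0 := by
        have := A'.longestPath_le_card
        rw [Fintype.card_eq_zero] at this
        simp [hK_def, Nat.le_zero.1 this]
      have := cumulative_le (T := T) (b := 0)
        (f := fun h ρ => (π'.1.map fun e => transitionGain P (out h) (y h) (lab e)).sum -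
          (ρ.1.map fun e => transitionGain P (out h) (y h) (lab e)).sum)
        (fun h _ ρ => by simp [hnil]) h hlen.le
      simpa [ha_def, hb_def, hKz] using this
    -- The sign of `B` is not assumed; it follows from one nonnegative transition gain in the first
    -- round.
    have hB : 0 ≤ B := (hgain [] e₀).trans (hgB [] hT e₀)
    have hgen := cumulative_le (T := T) (b := K * B)
      (f := fun h ρ => (π'.1.map fun e => transitionGain P (out h) (y h) (lab e)).sum -
        (ρ.1.map fun e => transitionGain P (out h) (y h) (lab e)).sum)
      (fun h hlt ρ => by
        have h1 := π'.sum_map_le hB (hgB h hlt)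
        have h2 : 0 ≤ (ρ.1.map fun e => transitionGain P (out h) (y h) (lab e)).sum :=
          List.sum_nonneg (by simpa using fun e _ => hgain h e)
        linarith) h hlen.le
    rw [hlen] at hgen
    rcases hmain with h' | h' | h' | h' | h' | h'
    · omega
    · exact (h'.false e₀).elim
    · have : B = 0 := le_antisymm h' hB
      simpa [this] using hgen
    · have hsub : Subsingleton A.AcceptingPath := Finite.card_le_one_iff_subsingleton.1 h'
      have := cumulative_le (T := T) (b := 0)
        (f := fun h ρ => (π'.1.map fun e => transitionGain P (out h) (y h) (lab e)).sum -
          (ρ.1.map fun e => transitionGain P (out h) (y h) (lab e)).sum)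
        (fun h _ ρ => by
          rw [← hπ.countGain_eq, ← (hσ ρ).countGain_eq, Subsingleton.elim (σ ρ) π, sub_self])
        h hlen.le
      refine this.trans ?_
      rw [mul_zero]
      positivity
    -- The threshold 16cn is where a reaches TK/2, so that 2Ba covers the trivial regret TKB; 4Ml
    -- plays the same role for b in the next case.
    · have : T * K / 2 ≤ a := by
        refine Real.le_sqrt_of_sq_le ?_
        calc (T * K / 2) ^ 2 = T * (T * K ^ 2 / 4) := by ring
          _ ≤ 16 * c * n * (T * K ^ 2 / 4) := by gcongr
          _ = _ := by ring
      nlinarith [mul_le_mul_of_nonneg_left this hB, mul_nonneg hB hb]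
    · have : T * K / 2 ≤ b := by
        refine Real.le_sqrt_of_sq_le ?_
        calc (T * K / 2) ^ 2 = T * K * (T * K / 4) := by ring
          _ ≤ 4 * M * l * (T * K / 4) := by gcongr
          _ = _ := by ring
      nlinarith [mul_le_mul_of_nonneg_left this hB, mul_nonneg hB ha]
  · push Not at hmain
    obtain ⟨hT, hX, hB, hN, hT1, hT2⟩ := hmain
    have hTpos : (0 : ℝ) < T := Nat.cast_pos.2 (Nat.pos_of_ne_zero hT)
    have hM1 : 1 ≤ M := Nat.one_le_cast.2 Fintype.card_pos
    have hn : 0 < n := Real.log_pos (Nat.one_lt_cast.2 hN)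
    have hl : 0 < l := Real.log_pos ((one_lt_div hδ0).2 (by linarith))
    have hK : 0 < K := by
      obtain ⟨e₀⟩ := hX
      obtain ⟨ρ, -, he⟩ := hcover e₀
      exact Nat.cast_pos.2 ((List.length_pos_of_mem he).trans_le ρ.length_le_longestPath)
    obtain ⟨prm, hβ, hη, hγ, heq⟩ := CDSB.exists_params hB hTpos hK
      (Nat.cast_le.2 A'.longestPath_le_card) hc hn hl hT1 hT2
    refine ⟨prm, fun out y hgB σ hσ => ?_⟩
    have hgain : ∀ h : List A'.AcceptingPath, h.length < T → ∀ e,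
        0 ≤ transitionGain P (out h) (y h) (lab e) := fun h _ e => transitionGain_nonneg _ _ _ _
    refine CDSB.one_sub_le_law hC hcover hgain hB hgB hβ hδ0 _ fun h hlen hconc π => ?_
    obtain ⟨π', hπ⟩ := hA'.exists_corresponds π
    rw [cumulativeRegret_eq_cumulative out y hσ hπ, ← heq]
    have hβ0 := prm.β_pos
    refine (CDSB.regret_le hC hcover hgain hB hgB hβ hη hγ h hlen (by positivity) hconc π').trans ?_
    have hη0 := prm.η_pos
    -- `regret_le` counts paths of `A'`, whereas the parameters were tuned to the number of experts.
    have hN' : Real.log A'.numPaths ≤ n := by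
      have : Nonempty A'.AcceptingPath := ⟨π'⟩
      refine Real.log_le_log (Nat.cast_pos.2 Nat.card_pos) (Nat.cast_le.2 ?_)
      exact Nat.card_le_card_of_injective σ (hA'.injective_of_corresponds hσ)
    gcongr
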